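/- Let $\Bbbk$ be a commutative ring; modules and linear maps are over $\Bbbk$. A pre-Lie algebra is a module $L$ with a bilinear product $\circ$ such that $X\circ(Y\circ Z)-(X\circ Y)\circ Z = X\circ(Z\circ Y)-(X\circ Z)\circ Y$ for all $X,Y,Z\in L$. For a module $V$, the symmetric algebra $S(V)$ carries its usual coproduct $\Delta$ (the algebra map for which the elements of $V$ are primitive), written in Sweedler notation. A symmetric brace algebra is a module $V$ with a linear map $V\otimes S(V)\to V$, $X\otimes A\mapsto X\{A\}$, such that $X\{1\}=X$ and $$X\{Y_1\cdots Y_n\}\{A\}=X\{Y_1\{A_{(1)}\}\cdots Y_n\{A_{(n)}\}\,A_{(n+1)}\}$$ for all $n\ge 0$, $X,Y_1,\dots,Y_n\in V$ and $A\in S(V)$. Morphisms of pre-Lie algebras are the linear maps preserving $\circ$; morphisms of symmetric brace algebras are the linear maps $f$ with $f(X\{A\})=f(X)\{S(f)(A)\}$. Given a bilinear product $\circ$ on a module $L$, extend it to words $A$ in elements of $L$ by $T\circ 1=T$ and $T\circ (BX)=(T\circ B)\circ X-T\circ(B\circ X)$ for $T, X\in L$ and a word $B=Y_1\cdots Y_n$,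 where $B\circ X=\sum_{i=1}^n Y_1\cdots (Y_i\circ X)\cdots Y_n$. 1. Let $(L,\circ)$ be a pre-Lie algebra. There is a unique symmetric brace algebra structure on the module $L$ such that $X\{Y_1\cdots Y_n\}=X\circ(Y_1\cdots Y_n)$ for all $n\ge 0$ and $X,Y_1,\dots,Y_n\in L$. 2. Let $V$ be a symmetric brace algebra, and put $X\circ Y=X\{Y\}$; this makes $V$ a pre-Lie algebra. Then $X\{Y_1\cdots Y_n\}=X\circ(Y_1\cdots Y_n)$ for all $n\ge 0$ and $X,Y_1,\dots,Y_n\in V$, where the right-hand side is the extension of the product $X\circ Y=X\{Y\}$. 3. The functor from symmetric brace algebras to pre-Lie algebras which keeps the underlying module and the underlying maps and sets $X\circ Y=X\{Y\}$ is an isomorphism of categories: it has a strict two-sided inverse functor, which sends $(L,\circ)$ to the module $L$ with the braces of part 1. -/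

import Mathlib

open CategoryTheory

universe u v

/-- The multilinear maps `∘₍ₙ₎ : L × Lⁿ → L` extending a product `m X Y = X ∘ Y` on `L`:
`T ∘ 1 = T` and, for a word `A = B X` with last letter `X` and `B = Y₁ ⋯ Yₙ`,
`T ∘ (B X) = (T ∘ B) ∘ X - T ∘ (B ∘ X)`, where
`B ∘ X = ∑ i, Y₁ ⋯ (Yᵢ ∘ X) ⋯ Yₙ`. -/
def extendedCirc {L : Type v} [AddCommGroup L] (m : L → L → L) :
    (n : ℕ) → L → (Fin n → L) → L
  | 0, T, _ => T
  | n + 1, T, Y =>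
      m (extendedCirc m n T (Fin.init Y)) (Y (Fin.last n)) -
        ∑ i : Fin n, extendedCirc m n T
          (Function.update (Fin.init Y) i (m (Fin.init Y i) (Y (Fin.last n))))

section Brace

variable (k : Type u) [CommRing k] {V : Type v} [AddCommGroup V] [Module k V]

/-- The monomial `Y₁ ⋯ Yₙ` in the symmetric algebra `S(V)`. -/
noncomputable def symMonomial {n : ℕ} (Y : Fin n → V) : SymmetricAlgebra k V :=
  ∏ i, SymmetricAlgebra.ι k V (Y i)

variable {k}

/-- For `b : V → S(V) → V`, `b X A = X{A}`, the linear map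
`A ↦ Y₁{A₍₁₎} ⋯ Yₙ{A₍ₙ₎} A₍ₙ₊₁₎` on `S(V)`. The coproduct is the one for which the elements
of `V` are primitive, i.e. the usual (un)shuffle coproduct of `S(V)`. -/
noncomputable def braceExpand (b : V →ₗ[k] SymmetricAlgebra k V →ₗ[k] V) :
    (n : ℕ) → (Fin n → V) → (SymmetricAlgebra k V →ₗ[k] SymmetricAlgebra k V)
  | 0, _ => LinearMap.id
  | n + 1, Y =>
      LinearMap.mul' k (SymmetricAlgebra k V) ∘ₗ
        TensorProduct.map (SymmetricAlgebra.ι k V ∘ₗ b (Y 0)) (braceExpand b n (Fin.tail Y)) ∘ₗ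
          Coalgebra.comul

variable (k V)

/-- A symmetric brace algebra structure on the `k`-module `V`. -/
@[ext]
structure SymmetricBrace where
  /-- The brace `X{A}`, for `X ∈ V` and `A ∈ S(V)`. -/
  brace : V →ₗ[k] SymmetricAlgebra k V →ₗ[k] V
  brace_one : ∀ X : V, brace X 1 = X
  /-- `X{Y₁ ⋯ Yₙ}{A} = X{Y₁{A₍₁₎} ⋯ Yₙ{A₍ₙ₎} A₍ₙ₊₁₎}` -/
  brace_brace : ∀ (n : ℕ) (X : V) (Y : Fin n → V) (A : SymmetricAlgebra k V),
    brace (brace X (symMonomial k Y)) A = brace X (braceExpand brace n Y A)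

variable {k V}

namespace SymmetricBrace

variable (B : SymmetricBrace k V)

/-- The product `X ∘ Y = X{Y}`. -/
noncomputable def circ (X Y : V) : V := B.brace X (SymmetricAlgebra.ι k V Y)

theorem circ_circ (X Y Z : V) :
    B.circ (B.circ X Y) Z = B.circ X (B.circ Y Z) +
      B.brace X (SymmetricAlgebra.ι k V Y * SymmetricAlgebra.ι k V Z) := by
  have h := B.brace_brace 1 X (fun _ => Y) (SymmetricAlgebra.ι k V Z)
  simpa [symMonomial, braceExpand, circ, B.brace_one] using h

/-- The right pre-Lie ring structure `X ∘ Y = X{Y}` on a symmetric brace algebra, with the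
same underlying additive group. -/
@[reducible] noncomputable def toRightPreLieRing : RightPreLieRing V :=
  { ‹AddCommGroup V› with
    mul := B.circ
    left_distrib := fun X Y Z => by
      change B.circ X (Y + Z) = B.circ X Y + B.circ X Z
      simp [circ]
    right_distrib := fun X Y Z => by
      change B.circ (X + Y) Z = B.circ X Z + B.circ Y Z
      simp [circ]
    zero_mul := fun X => by
      change B.circ 0 X = 0
      simp [circ]
    mul_zero := fun X => by
      change B.circ X 0 = 0
      simp [circ]
    assoc_symm' := fun X Y Z => by
      change B.circ (B.circ X Y) Z - B.circ X (B.circ Y Z) =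
        B.circ (B.circ X Z) Y - B.circ X (B.circ Z Y)
      rw [circ_circ, circ_circ, add_sub_cancel_left, add_sub_cancel_left, mul_comm] }

/-- The pre-Lie algebra structure `X ∘ Y = X{Y}` on a symmetric brace algebra, with the same
underlying `k`-module. -/
@[reducible] noncomputable def toRightPreLieAlgebra :
    @RightPreLieAlgebra k _ V B.toRightPreLieRing :=
  letI := B.toRightPreLieRing
  { ‹Module k V› with
    smul_assoc := fun r X Y => by
      change B.circ (r • X) Y = r • B.circ X Y
      simp [circ]
    smul_comm := fun r X Y => by
      change r • B.circ X Y = B.circ X (r • Y)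
      simp [circ] }

end SymmetricBrace

end Brace

/-- The algebra map `S(f) : S(V) → S(W)` induced by a linear map `f : V → W`. -/
noncomputable def symMap {k : Type u} [CommRing k] {V W : Type v} [AddCommGroup V] [Module k V]
    [AddCommGroup W] [Module k W] (f : V →ₗ[k] W) :
    SymmetricAlgebra k V →ₐ[k] SymmetricAlgebra k W :=
  SymmetricAlgebra.lift (SymmetricAlgebra.ι k W ∘ₗ f)

section Categories

/-- The underlying additive group of a pre-Lie ring (a shortcut for instance search). -/
instance rightPreLieAddCommGroup {L : Type v} [RightPreLieRing L] : AddCommGroup L :=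
  NonUnitalNonAssocRing.toAddCommGroup

/-- The underlying module of a pre-Lie algebra (a shortcut for instance search). -/
instance rightPreLieModule {k : Type u} [CommRing k] {L : Type v} [RightPreLieRing L]
    [RightPreLieAlgebra k L] : Module k L :=
  RightPreLieAlgebra.toModule

variable (k : Type u) [CommRing k]

/-- The objects of the category of pre-Lie algebras over `k`: the associator is symmetric in the
last two variables. -/
structure PreLieAlgCat where
  carrier : Type v
  [ring : RightPreLieRing carrier]
  [alg : RightPreLieAlgebra k carrier]

attribute [instance] PreLieAlgCat.ring PreLieAlgCat.alg

/-- Morphisms of pre-Lie algebras are the `k`-linear maps preserving the product. -/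
instance : Category.{v} (PreLieAlgCat.{u, v} k) where
  Hom L M := L.carrier →ₙₐ[k] M.carrier
  id L := NonUnitalAlgHom.id k L.carrier
  comp f g := g.comp f

/-- The objects of the category of symmetric brace algebras over `k`. -/
structure SymBraceAlgCat where
  carrier : Type v
  [grp : AddCommGroup carrier]
  [mod : Module k carrier]
  str : SymmetricBrace k carrier

attribute [instance] SymBraceAlgCat.grp SymBraceAlgCat.mod

variable {k}

/-- Morphisms of symmetric brace algebras: `k`-linear maps `f` such that
`f (X{A}) = (f X){S(f) A}`. -/
@[ext]
structure SymBraceHom (V W : SymBraceAlgCat.{u, v} k) where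
  lin : V.carrier →ₗ[k] W.carrier
  map_brace : ∀ (X : V.carrier) (A : SymmetricAlgebra k V.carrier),
    lin (V.str.brace X A) = W.str.brace (lin X) (symMap lin A)

variable (k)

noncomputable instance : Category.{v} (SymBraceAlgCat.{u, v} k) where
  Hom V W := SymBraceHom V W
  id V := ⟨LinearMap.id, fun X A => by simp [symMap]⟩
  comp {U V W} f g := ⟨g.lin ∘ₗ f.lin, fun X A => by
    have h : symMap (g.lin ∘ₗ f.lin) = (symMap g.lin).comp (symMap f.lin) := by
      ext x
      simp [symMap]
    simp [h, f.map_brace, g.map_brace]⟩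

/-- The functor sending a symmetric brace algebra `V` to the pre-Lie algebra `V` with the product
`X ∘ Y = X{Y}`, and a morphism to the same underlying map. -/
noncomputable def symBraceToPreLie : SymBraceAlgCat.{u, v} k ⥤ PreLieAlgCat.{u, v} k where
  obj V := @PreLieAlgCat.mk k _ V.carrier V.str.toRightPreLieRing V.str.toRightPreLieAlgebra
  map {V W} f :=
    letI := V.str.toRightPreLieRing
    letI := V.str.toRightPreLieAlgebra
    letI := W.str.toRightPreLieRing
    letI := W.str.toRightPreLieAlgebra
    { toFun := f.lin
      map_smul' := fun r X => f.lin.map_smul r X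
      map_zero' := f.lin.map_zero
      map_add' := f.lin.map_add
      map_mul' := fun X Y => by
        change f.lin (V.str.circ X Y) = W.str.circ (f.lin X) (f.lin Y)
        simp [SymmetricBrace.circ, f.map_brace, symMap] }

end Categories

/-! The crux is that `T ∘ (Y₁ ⋯ Yₙ)`, defined by recursion on the last letter, is symmetric in the
`Yᵢ`. Let `U = U(L)` for the commutator bracket; right multiplications make `L` a right `U`-module.
On linear maps `f : U → L` put `(f·Y)(w) = f(w₁) ∘ (Y·w₂) - f(w₁ (Y·w₂))`. The pre-Lie identity
makes these operators commute (`rightOp_comm`), so `S(L)` acts on `Hom(U, L)`. Letting it act on `w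
↦ ε(w) T` and evaluating at `1` gives `φ` with `φ T (B X) = φ T B ∘ X - φ T (D_X B)`, where `D_X` is
the derivation extending `Y ↦ Y ∘ X` (`exists_symmetric_extension`).

The brace axiom follows by induction on the length of `A`, because `D_X` is also a coderivation
(`comul_symDerivation`, `braceExpand_mul_ι`). Conversely, the axiom with `A ∈ V` is the same
recursion, so the product determines the braces (`brace_symMonomial`). Monomials span `S(V)`, whence
uniqueness and strictly inverse functors. -/

open scoped TensorProduct

/-! ### Derivations, monomials and coproduct of the symmetric algebra. -/

section SymmetricAlgebraLemmas

variable {k : Type u} [CommRing k] {V : Type v} [AddCommGroup V] [Module k V]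

/-- The derivation of `S(V)` extending an endomorphism of `V`. -/
noncomputable def symDerivation (g : V →ₗ[k] V) :
    Derivation k (SymmetricAlgebra k V) (SymmetricAlgebra k V) :=
  -- Dual numbers: `F` is `a ↦ a + ε D(a)`, and the derivation is its `ε`-component.
  let F : SymmetricAlgebra k V →ₐ[k]
      TrivSqZeroExt (SymmetricAlgebra k V) (SymmetricAlgebra k V) :=
    SymmetricAlgebra.lift
      ((TrivSqZeroExt.inlAlgHom k _ _).toLinearMap ∘ₗ SymmetricAlgebra.ι k V +
        (TrivSqZeroExt.inrHom _ _).restrictScalars k ∘ₗ SymmetricAlgebra.ι k V ∘ₗ g)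
  have hF : ∀ a, (F a).fst = a := fun a => by
    have h : (TrivSqZeroExt.fstHom k (SymmetricAlgebra k V) (SymmetricAlgebra k V)).comp F =
        AlgHom.id k _ := by
      ext x
      simp [F]
    exact congr($h a)
  Derivation.mk' ((TrivSqZeroExt.sndHom _ _).restrictScalars k ∘ₗ F.toLinearMap) fun a b => by
    simp [hF, mul_comm]

@[simp]
theorem symDerivation_ι (g : V →ₗ[k] V) (x : V) :
    symDerivation g (SymmetricAlgebra.ι k V x) = SymmetricAlgebra.ι k V (g x) := by
  simp [symDerivation]

@[simp]
theorem symMonomial_zero (Y : Fin 0 → V) : symMonomial k Y = 1 := by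
  simp [symMonomial]

theorem symMonomial_init {n : ℕ} (Y : Fin (n + 1) → V) :
    symMonomial k Y =
      symMonomial k (Fin.init Y) * SymmetricAlgebra.ι k V (Y (Fin.last n)) := by
  simp [symMonomial, Fin.prod_univ_castSucc, Fin.init]

theorem symMonomial_tail {n : ℕ} (Y : Fin (n + 1) → V) :
    symMonomial k Y = SymmetricAlgebra.ι k V (Y 0) * symMonomial k (Fin.tail Y) := by
  simp [symMonomial, Fin.prod_univ_succ, Fin.tail]

theorem symMonomial_append {m n : ℕ} (Y : Fin m → V) (Z : Fin n → V) :
    symMonomial k (Fin.append Y Z) = symMonomial k Y * symMonomial k Z := by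
  simp [symMonomial, Fin.prod_univ_add]

theorem symDerivation_symMonomial (g : V →ₗ[k] V) {n : ℕ} (Y : Fin n → V) :
    symDerivation g (symMonomial k Y) =
      ∑ i, symMonomial k (Function.update Y i (g (Y i))) := by
  induction n with
  | zero => simp
  | succ n ih =>
    rw [symMonomial_init, Derivation.leibniz, ih, Fin.sum_univ_castSucc, add_comm]
    congr 1
    · rw [smul_eq_mul, Finset.mul_sum]
      refine Finset.sum_congr rfl fun i _ => ?_
      rw [symMonomial_init, Fin.init_update_castSucc, mul_comm,
        Function.update_of_ne (Fin.castSucc_lt_last i).ne']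
      rfl
    · rw [symMonomial_init, Fin.init_update_last]
      simp

theorem span_symMonomial :
    Submodule.span k (Set.range fun Y : (Σ n : ℕ, Fin n → V) => symMonomial k Y.2) = ⊤ := by
  rw [eq_top_iff]
  rintro a -
  induction a using SymmetricAlgebra.induction with
  | algebraMap r =>
    rw [Algebra.algebraMap_eq_smul_one]
    exact Submodule.smul_mem _ _ (Submodule.subset_span ⟨⟨0, Fin.elim0⟩, by simp⟩)
  | ι x => exact Submodule.subset_span ⟨⟨1, fun _ => x⟩, by simp [symMonomial]⟩
  | mul a b ha hb =>
    have h := Submodule.mul_mem_mul ha hb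
    rw [Submodule.span_mul_span] at h
    refine Submodule.span_mono ?_ h
    rintro _ ⟨_, ⟨Y, rfl⟩, _, ⟨Z, rfl⟩, rfl⟩
    exact ⟨⟨_, Fin.append Y.2 Z.2⟩, symMonomial_append _ _⟩
  | add a b ha hb => exact add_mem ha hb

theorem linearMap_ext_symMonomial {M : Type*} [AddCommGroup M] [Module k M]
    {f g : SymmetricAlgebra k V →ₗ[k] M}
    (h : ∀ (n : ℕ) (Y : Fin n → V), f (symMonomial k Y) = g (symMonomial k Y)) : f = g :=
  LinearMap.ext_on span_symMonomial (by rintro _ ⟨Y, rfl⟩; exact h _ _)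

theorem comul_mul_ι (a : SymmetricAlgebra k V) (x : V) :
    Coalgebra.comul (R := k) (a * SymmetricAlgebra.ι k V x) =
      Coalgebra.comul (R := k) a *
        (SymmetricAlgebra.ι k V x ⊗ₜ[k] 1 + 1 ⊗ₜ[k] SymmetricAlgebra.ι k V x) := by
  rw [Bialgebra.comul_mul, SymmetricAlgebra.comul_ι]

/-- Both sides obey the same Leibniz rule along `Δ` and agree on the primitive elements of `V`;
`key` is that rule for the right-hand side with one letter appended. -/
theorem comul_symDerivation (g : V →ₗ[k] V) (a : SymmetricAlgebra k V) :
    Coalgebra.comul (R := k) (symDerivation g a) =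
      (symDerivation g).toLinearMap.rTensor _ (Coalgebra.comul (R := k) a) +
        (symDerivation g).toLinearMap.lTensor _ (Coalgebra.comul (R := k) a) := by
  have key : ∀ (t : SymmetricAlgebra k V ⊗[k] SymmetricAlgebra k V) (x : V),
      (symDerivation g).toLinearMap.rTensor _
          (t * (SymmetricAlgebra.ι k V x ⊗ₜ[k] 1 + 1 ⊗ₜ[k] SymmetricAlgebra.ι k V x)) +
        (symDerivation g).toLinearMap.lTensor _
          (t * (SymmetricAlgebra.ι k V x ⊗ₜ[k] 1 + 1 ⊗ₜ[k] SymmetricAlgebra.ι k V x)) =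
      ((symDerivation g).toLinearMap.rTensor _ t + (symDerivation g).toLinearMap.lTensor _ t) *
          (SymmetricAlgebra.ι k V x ⊗ₜ[k] 1 + 1 ⊗ₜ[k] SymmetricAlgebra.ι k V x) +
        t * (SymmetricAlgebra.ι k V (g x) ⊗ₜ[k] 1 +
          1 ⊗ₜ[k] SymmetricAlgebra.ι k V (g x)) := by
    intro t x
    induction t with
    | zero => simp
    | add s t hs ht =>
      simp only [add_mul, map_add] at hs ht ⊢
      linear_combination hs + ht
    | tmul a b =>
      simp only [mul_add, add_mul, Algebra.TensorProduct.tmul_mul_tmul, map_add,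
        LinearMap.rTensor_tmul, LinearMap.lTensor_tmul,
        Derivation.coeFn_coe, Derivation.leibniz, mul_one, symDerivation_ι, smul_eq_mul,
        TensorProduct.add_tmul, TensorProduct.tmul_add,
        mul_comm (SymmetricAlgebra.ι k V x)]
      abel
  suffices h : Coalgebra.comul ∘ₗ (symDerivation g).toLinearMap =
      ((symDerivation g).toLinearMap.rTensor _ + (symDerivation g).toLinearMap.lTensor _) ∘ₗ
        Coalgebra.comul from congr($h a)
  refine linearMap_ext_symMonomial fun n Y => ?_
  induction n with
  | zero => simp [Algebra.TensorProduct.one_def]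
  | succ n ih =>
    have ih' := ih (Fin.init Y)
    simp only [LinearMap.comp_apply, LinearMap.add_apply,
      Derivation.coeFn_coe] at ih' key ⊢
    rw [symMonomial_init, comul_mul_ι, key, ← ih', Derivation.leibniz, map_add, smul_eq_mul,
      smul_eq_mul, Bialgebra.comul_mul, symDerivation_ι, SymmetricAlgebra.comul_ι,
      mul_comm (SymmetricAlgebra.ι k V _), comul_mul_ι, add_comm]

end SymmetricAlgebraLemmas

/-! ### Commuting families of operators, and induction on words in `U(L)`. -/

/-- A linear map with commuting values extends to the symmetric algebra. -/
theorem SymmetricAlgebra.exists_algHom_of_commute {k V A : Type*} [CommRing k] [AddCommGroup V]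
    [Module k V] [Ring A] [Algebra k A] (P : V →ₗ[k] A) (hP : ∀ x y, P x * P y = P y * P x) :
    ∃ ρ : SymmetricAlgebra k V →ₐ[k] A, ∀ x, ρ (SymmetricAlgebra.ι k V x) = P x := by
  -- The universal property needs a commutative target: the subalgebra generated by the values of
  -- `P`.
  have : IsMulCommutative (Algebra.adjoin k (Set.range P)) :=
    Algebra.isMulCommutative_adjoin k (by
      rintro _ ⟨x, rfl⟩ _ ⟨y, rfl⟩
      exact hP x y)
  let : CommRing (Algebra.adjoin k (Set.range P)) :=
    { (inferInstance : Ring (Algebra.adjoin k (Set.range P))) with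
      mul_comm := fun a b => mul_comm' a b }
  let P' : V →ₗ[k] Algebra.adjoin k (Set.range P) :=
    P.codRestrict (Subalgebra.toSubmodule (Algebra.adjoin k (Set.range P)))
      fun x => Algebra.subset_adjoin ⟨x, rfl⟩
  refine ⟨(Algebra.adjoin k (Set.range P)).val.comp (SymmetricAlgebra.lift P'), fun x => ?_⟩
  rw [AlgHom.comp_apply, SymmetricAlgebra.lift_ι_apply]
  rfl

attribute [local instance] LieRing.ofAssociativeRing

theorem UniversalEnvelopingAlgebra.submodule_eq_top {k L : Type*} [CommRing k] [LieRing L]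
    [LieAlgebra k L] (S : Submodule k (UniversalEnvelopingAlgebra k L)) (h1 : 1 ∈ S)
    (hS : ∀ x w, w ∈ S → UniversalEnvelopingAlgebra.ι k x * w ∈ S) : S = ⊤ := by
  have h : ∀ (a : TensorAlgebra k L), ∀ w ∈ S, mkAlgHom k L a * w ∈ S := by
    intro a
    induction a using TensorAlgebra.induction with
    | algebraMap r =>
      intro w hw
      rw [AlgHom.commutes, ← Algebra.smul_def]
      exact S.smul_mem r hw
    | ι x => exact hS x
    | mul a b ha hb =>
      intro w hw
      rw [map_mul, mul_assoc]
      exact ha _ (hb _ hw)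
    | add a b ha hb =>
      intro w hw
      rw [map_add, add_mul]
      exact add_mem (ha _ hw) (hb _ hw)
  rw [eq_top_iff]
  rintro w -
  obtain ⟨a, rfl⟩ : ∃ a, mkAlgHom k L a = w := Quotient.mk_surjective w
  simpa using h a 1 h1

/-! ### Operators on `Hom(U(L), L)` and the symmetric extension of the product. -/

namespace RightPreLieAlgebra

variable (k : Type u) [CommRing k] {L : Type v} [RightPreLieRing L] [RightPreLieAlgebra k L]

/-- Right multiplication `Y ↦ Y ∘ X`. -/
def mulRight (X : L) : L →ₗ[k] L := (LinearMap.mul k L).flip X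

@[simp]
theorem mulRight_apply (X Y : L) : mulRight k X Y = Y * X := rfl

/-- The algebra map `U(L) → U(L) ⊗ End(L)ᵒᵖ` through which `U(L)` acts on products of
functions on it with elements of `L`. -/
noncomputable def coaction : UniversalEnvelopingAlgebra k L →ₐ[k]
    UniversalEnvelopingAlgebra k L ⊗[k] (Module.End k L)ᵐᵒᵖ :=
  UniversalEnvelopingAlgebra.lift k
    { toFun x := UniversalEnvelopingAlgebra.ι k x ⊗ₜ 1 + 1 ⊗ₜ MulOpposite.op (mulRight k x)
      map_add' x y := by
        have h : mulRight k (x + y) = mulRight k x + mulRight k y := by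
          ext z; simp [mul_add]
        rw [h, map_add, MulOpposite.op_add, TensorProduct.add_tmul, TensorProduct.tmul_add]
        abel
      map_smul' r x := by
        have h : mulRight k (r • x) = r • mulRight k x := by
          ext z; simp [mul_smul_comm]
        rw [h, map_smul, MulOpposite.op_smul, ← TensorProduct.smul_tmul', TensorProduct.tmul_smul,
          RingHom.id_apply, smul_add]
      map_lie' {x y} := by
        -- The pre-Lie identity says that right multiplications form a right Lie action, hence the
        -- opposite algebra.
        have h : mulRight k ⁅x, y⁆ = mulRight k y * mulRight k x - mulRight k x * mulRight k y := by
          ext z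
          have := RightPreLieRing.assoc_symm z x y
          simp only [associator_apply] at this
          simp only [mulRight_apply, LinearMap.sub_apply, Module.End.mul_apply,
            Ring.lie_def, mul_sub]
          grind
        rw [h, LieHom.map_lie, Ring.lie_def, Ring.lie_def, MulOpposite.op_sub,
          MulOpposite.op_mul, MulOpposite.op_mul]
        simp only [mul_add, add_mul, Algebra.TensorProduct.tmul_mul_tmul, mul_one, one_mul,
          TensorProduct.sub_tmul, TensorProduct.tmul_sub]
        abel }

theorem coaction_ι (x : L) : coaction k (UniversalEnvelopingAlgebra.ι k x) =
    UniversalEnvelopingAlgebra.ι k x ⊗ₜ 1 + 1 ⊗ₜ MulOpposite.op (mulRight k x) :=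
  UniversalEnvelopingAlgebra.lift_ι_apply _ _ _

/-- Precomposition with left multiplication by `x ∈ L` on functions `U(L) → L`. -/
noncomputable def translate (x : L) : Module.End k (UniversalEnvelopingAlgebra k L →ₗ[k] L) :=
  LinearMap.lcomp k L (LinearMap.mulLeft k (UniversalEnvelopingAlgebra.ι k x))

@[simp]
theorem translate_apply (x : L) (f : UniversalEnvelopingAlgebra k L →ₗ[k] L)
    (w : UniversalEnvelopingAlgebra k L) :
    translate k x f w = f (UniversalEnvelopingAlgebra.ι k x * w) := rfl

/-- The linear map `u ⊗ g ↦ f(u) ∘ g(Y) - f(u · g(Y))`. -/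
noncomputable def contract (Y : L) (f : UniversalEnvelopingAlgebra k L →ₗ[k] L) :
    UniversalEnvelopingAlgebra k L ⊗[k] (Module.End k L)ᵐᵒᵖ →ₗ[k] L :=
  TensorProduct.lift
    ((LinearMap.mul k L ∘ₗ f -
      ((LinearMap.mul k _).compl₂ (UniversalEnvelopingAlgebra.ι k (L := L)).toLinearMap).compr₂
        f).compl₂
      (LinearMap.applyₗ Y ∘ₗ (MulOpposite.opLinearEquiv k).symm.toLinearMap))

@[simp]
theorem contract_tmul (Y : L) (f : UniversalEnvelopingAlgebra k L →ₗ[k] L)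
    (u : UniversalEnvelopingAlgebra k L) (g : (Module.End k L)ᵐᵒᵖ) :
    contract k Y f (u ⊗ₜ g) =
      f u * g.unop Y - f (u * UniversalEnvelopingAlgebra.ι k (g.unop Y)) := rfl

/-- `x ⊗ 1` multiplies `u` on the left, away from the letter that `contract` inserts on the right;
the other summand replaces `Y` by `Y * x` before `g` acts. -/
theorem contract_coaction_mul (x Y : L) (f : UniversalEnvelopingAlgebra k L →ₗ[k] L)
    (t : UniversalEnvelopingAlgebra k L ⊗[k] (Module.End k L)ᵐᵒᵖ) :
    contract k Y f (coaction k (UniversalEnvelopingAlgebra.ι k x) * t) =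
      contract k Y (translate k x f) t + contract k (Y * x) f t := by
  rw [coaction_ι]
  induction t with
  | zero => simp
  | add s t hs ht => simp only [mul_add, map_add, hs, ht]; abel
  | tmul u g =>
    simp [add_mul, mul_assoc]

/-- The operators `f ↦ f · Y` on functions `U(L) → L`. -/
noncomputable def rightOp : L →ₗ[k] Module.End k (UniversalEnvelopingAlgebra k L →ₗ[k] L) :=
  LinearMap.mk₂ k (fun Y f => contract k Y f ∘ₗ (coaction k).toLinearMap)
    (fun Y Z f => by
      rw [← LinearMap.add_comp]; congr 1; ext; simp [mul_add]; abel)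
    (fun r Y f => by
      rw [← LinearMap.smul_comp]; congr 1; ext u g; simp [smul_sub]; exact mul_smul_comm r (f u) (g.unop Y))
    (fun Y f g => by
      rw [← LinearMap.add_comp]; congr 1; ext; simp [add_mul]; abel)
    (fun r Y f => by
      rw [← LinearMap.smul_comp]; congr 1; ext u g; simp [smul_sub]; exact smul_mul_assoc r (f u) (g.unop Y))

theorem rightOp_apply_one (Y : L) (f : UniversalEnvelopingAlgebra k L →ₗ[k] L) :
    rightOp k Y f 1 = f 1 * Y - f (UniversalEnvelopingAlgebra.ι k Y) := by
  change contract k Y f (coaction k 1) = _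
  simp [Algebra.TensorProduct.one_def]

/-- With `rightOp_apply_one`, this determines `rightOp` by induction on words. -/
theorem translate_rightOp (x Y : L) (f : UniversalEnvelopingAlgebra k L →ₗ[k] L) :
    translate k x (rightOp k Y f) = rightOp k Y (translate k x f) + rightOp k (Y * x) f := by
  ext w
  change contract k Y f (coaction k (_ * w)) = _
  rw [map_mul, contract_coaction_mul]
  rfl

theorem rightOp_comm (X Y : L) (f : UniversalEnvelopingAlgebra k L →ₗ[k] L) :
    rightOp k X (rightOp k Y f) = rightOp k Y (rightOp k X f) := by
  let S : Submodule k (UniversalEnvelopingAlgebra k L) :=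
    ⨅ (X : L) (Y : L) (f : UniversalEnvelopingAlgebra k L →ₗ[k] L),
      LinearMap.eqLocus (rightOp k X (rightOp k Y f)) (rightOp k Y (rightOp k X f))
  have hS : ∀ w, w ∈ S ↔ ∀ X Y f,
      rightOp k X (rightOp k Y f) w = rightOp k Y (rightOp k X f) w := by
    simp [S]
  have h : S = ⊤ := by
    refine UniversalEnvelopingAlgebra.submodule_eq_top _ ((hS _).2 fun X Y f => ?_)
      fun x w hw => (hS _).2 fun X Y f => ?_
    -- The terms in `f 1` are symmetric in `X, Y` by the pre-Lie identity, the terms `f(XY) + f(Y ∘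
    -- X)` by the commutator relation in `U(L)`, the other two visibly.
    · have e : ∀ X Y : L, rightOp k X (rightOp k Y f) 1 = f 1 * Y * X -
          f (UniversalEnvelopingAlgebra.ι k Y) * X - f (UniversalEnvelopingAlgebra.ι k X) * Y +
          f (UniversalEnvelopingAlgebra.ι k X * UniversalEnvelopingAlgebra.ι k Y) -
          f 1 * (Y * X) + f (UniversalEnvelopingAlgebra.ι k (Y * X)) := fun X Y => by
        have h := congr($(translate_rightOp k X Y f) 1)
        rw [translate_apply, mul_one, LinearMap.add_apply, rightOp_apply_one, rightOp_apply_one,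
          translate_apply, translate_apply, mul_one] at h
        rw [rightOp_apply_one, rightOp_apply_one, h, sub_mul]
        abel
      have h1 := congr(f $(LieHom.map_lie (UniversalEnvelopingAlgebra.ι k) X Y))
      rw [Ring.lie_def, Ring.lie_def, map_sub, map_sub, map_sub] at h1
      have h2 := RightPreLieRing.assoc_symm (f 1) X Y
      simp only [associator_apply] at h2
      rw [e, e]
      grind
    · rw [hS] at hw
      -- The letters and the function change here, so `S` must quantify over all of them.
      have e : ∀ X Y : L, rightOp k X (rightOp k Y f) (UniversalEnvelopingAlgebra.ι k x * w) =
          rightOp k X (rightOp k Y (translate k x f)) w + rightOp k X (rightOp k (Y * x) f) w +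
            rightOp k (X * x) (rightOp k Y f) w := fun X Y => by
        rw [← translate_apply, translate_rightOp, translate_rightOp, map_add]
        rfl
      rw [e, e, hw X Y, hw X (Y * x), hw (X * x) Y]
      abel
  ext w
  exact (hS w).1 (h ▸ Submodule.mem_top) X Y f

/-- The unique extension of the product to `S(L)` on the right. -/
theorem exists_symmetric_extension : ∃ φ : L →ₗ[k] SymmetricAlgebra k L →ₗ[k] L,
    (∀ T, φ T 1 = T) ∧ ∀ T B X, φ T (B * SymmetricAlgebra.ι k L X) =
      φ T B * X - φ T (symDerivation (mulRight k X) B) := by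
  obtain ⟨ρ, hρ⟩ := SymmetricAlgebra.exists_algHom_of_commute (rightOp k (L := L)) fun x y =>
    LinearMap.ext (rightOp_comm k x y)
  let ε : UniversalEnvelopingAlgebra k L →ₐ[k] k := UniversalEnvelopingAlgebra.lift k 0
  have hε : ∀ x : L, ε (UniversalEnvelopingAlgebra.ι k x) = 0 := fun x =>
    UniversalEnvelopingAlgebra.lift_ι_apply _ _ _
  let c : L →ₗ[k] UniversalEnvelopingAlgebra k L →ₗ[k] L :=
    LinearMap.flip ((LinearMap.lsmul k L).comp ε.toLinearMap)
  have hc : ∀ T w, c T w = ε w • T := fun _ _ => rfl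
  have key : ∀ (x : L) (B : SymmetricAlgebra k L) (f : UniversalEnvelopingAlgebra k L →ₗ[k] L),
      translate k x (ρ B f) = ρ B (translate k x f) + ρ (symDerivation (mulRight k x) B) f := by
    intro x B
    induction B using SymmetricAlgebra.induction with
    | algebraMap r => simp
    | ι Y => simpa [hρ] using translate_rightOp k x Y
    | mul A B hA hB =>
      intro f
      rw [map_mul, Module.End.mul_apply, hA, hB, Derivation.leibniz, map_add, smul_eq_mul,
        smul_eq_mul, mul_comm B, map_add, map_mul, map_mul]
      simp only [LinearMap.add_apply, Module.End.mul_apply]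
      abel
    | add A B hA hB =>
      intro f
      simp only [map_add, LinearMap.add_apply, hA, hB]
      abel
  refine ⟨LinearMap.mk₂ k (fun T A => ρ A (c T) 1) (by simp) (by simp) (by simp) (by simp),
    fun T => by simp [hc], fun T B X => ?_⟩
  -- Since `c T` is killed, translating `ρ B (c T)` by `X` only applies the derivation to `B`.
  have hX : translate k X (c T) = 0 := by
    ext w
    rw [translate_apply, hc, map_mul, hε, zero_mul, zero_smul, LinearMap.zero_apply]
  have h := congr($(key X B (c T)) 1)
  rw [hX, map_zero, zero_add, translate_apply, mul_one] at h
  simp only [LinearMap.mk₂_apply]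
  -- Commutativity of `S(L)` makes `rightOp k X` the outer operator, which can be evaluated at `1`.
  rw [mul_comm, map_mul, Module.End.mul_apply, hρ, rightOp_apply_one, h]

end RightPreLieAlgebra

/-! ### Braces are determined by the product. -/

theorem map_extendedCirc {L M : Type v} [AddCommGroup L] [AddCommGroup M] (m : L → L → L)
    (m' : M → M → M) (f : L →+ M) (hf : ∀ x y, f (m x y) = m' (f x) (f y)) (n : ℕ) (T : L)
    (Y : Fin n → L) : f (extendedCirc m n T Y) = extendedCirc m' n (f T) (f ∘ Y) := by
  induction n with
  | zero => rfl
  | succ n ih =>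
    simp only [extendedCirc, map_sub, map_sum, hf, ih, Function.comp_update]
    rfl

namespace SymmetricBrace

variable {k : Type u} [CommRing k] {V : Type v} [AddCommGroup V] [Module k V]

theorem braceExpand_one (B : SymmetricBrace k V) (n : ℕ) (Y : Fin n → V) :
    braceExpand B.brace n Y 1 = symMonomial k Y := by
  induction n with
  | zero => simp [braceExpand]
  | succ n ih =>
    simp [braceExpand, Algebra.TensorProduct.one_def, B.brace_one, ih, symMonomial_tail]

/-- As `Z` is primitive, it is either absorbed by one `Yᵢ` or left over as a factor. -/
theorem braceExpand_ι (B : SymmetricBrace k V) (n : ℕ) (Y : Fin n → V) (Z : V) :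
    braceExpand B.brace n Y (SymmetricAlgebra.ι k V Z) =
      symDerivation (B.brace.flip (SymmetricAlgebra.ι k V Z)) (symMonomial k Y) +
        symMonomial k Y * SymmetricAlgebra.ι k V Z := by
  induction n with
  | zero => simp [braceExpand]
  | succ n ih =>
    simp [braceExpand, B.brace_one, ih, braceExpand_one, symMonomial_tail]
    ring

/-- The braces of a symmetric brace algebra are determined by the product `X ∘ Y = X{Y}`. -/
theorem brace_symMonomial (B : SymmetricBrace k V) (n : ℕ) (X : V) (Y : Fin n → V) :
    B.brace X (symMonomial k Y) = extendedCirc B.circ n X Y := by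
  induction n with
  | zero => simp [extendedCirc, B.brace_one]
  | succ n ih =>
    have h := B.brace_brace n X (Fin.init Y) (SymmetricAlgebra.ι k V (Y (Fin.last n)))
    rw [braceExpand_ι, map_add, symDerivation_symMonomial, map_sum, ← symMonomial_init, ih] at h
    rw [eq_sub_of_add_eq' h.symm]
    simp only [ih]
    rfl

theorem eq_of_brace_symMonomial {B C : SymmetricBrace k V}
    (h : ∀ (n : ℕ) (X : V) (Y : Fin n → V),
      B.brace X (symMonomial k Y) = C.brace X (symMonomial k Y)) : B = C :=
  SymmetricBrace.ext (LinearMap.ext fun X => linearMap_ext_symMonomial fun n Y => h n X Y)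

end SymmetricBrace

theorem symMap_symMonomial {k : Type u} [CommRing k] {V W : Type v} [AddCommGroup V] [Module k V]
    [AddCommGroup W] [Module k W] (f : V →ₗ[k] W) {n : ℕ} (Y : Fin n → V) :
    symMap f (symMonomial k Y) = symMonomial k (f ∘ Y) := by
  simp [symMap, symMonomial]

/-! ### The brace axiom for the extended product. -/

namespace RightPreLieAlgebra

variable {k : Type u} [CommRing k] {L : Type v} [RightPreLieRing L] [RightPreLieAlgebra k L]

/-- On `Δ(A X)`, the recursion `hφ` treats the first tensor factor and induction the second; the
coderivation property recombines the two subtracted terms. -/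
theorem braceExpand_mul_ι {φ : L →ₗ[k] SymmetricAlgebra k L →ₗ[k] L}
    (hφ : ∀ T B X, φ T (B * SymmetricAlgebra.ι k L X) =
      φ T B * X - φ T (symDerivation (mulRight k X) B))
    (n : ℕ) (Y : Fin n → L) (X : L) (A : SymmetricAlgebra k L) :
    braceExpand φ n Y (A * SymmetricAlgebra.ι k L X) =
      braceExpand φ n Y A * SymmetricAlgebra.ι k L X +
        symDerivation (mulRight k X) (braceExpand φ n Y A) -
          braceExpand φ n Y (symDerivation (mulRight k X) A) := by
  induction n generalizing A with
  | zero => simp [braceExpand]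
  | succ n ih =>
    have key : ∀ t : SymmetricAlgebra k L ⊗[k] SymmetricAlgebra k L,
        LinearMap.mul' k (SymmetricAlgebra k L)
          (TensorProduct.map (SymmetricAlgebra.ι k L ∘ₗ φ (Y 0)) (braceExpand φ n (Fin.tail Y))
            (t * (SymmetricAlgebra.ι k L X ⊗ₜ[k] 1 + 1 ⊗ₜ[k] SymmetricAlgebra.ι k L X))) =
        LinearMap.mul' k (SymmetricAlgebra k L)
          (TensorProduct.map (SymmetricAlgebra.ι k L ∘ₗ φ (Y 0)) (braceExpand φ n (Fin.tail Y))
            t) * SymmetricAlgebra.ι k L X +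
        symDerivation (mulRight k X) (LinearMap.mul' k (SymmetricAlgebra k L)
          (TensorProduct.map (SymmetricAlgebra.ι k L ∘ₗ φ (Y 0)) (braceExpand φ n (Fin.tail Y))
            t)) -
        LinearMap.mul' k (SymmetricAlgebra k L)
          (TensorProduct.map (SymmetricAlgebra.ι k L ∘ₗ φ (Y 0)) (braceExpand φ n (Fin.tail Y))
            ((symDerivation (mulRight k X)).toLinearMap.rTensor _ t +
              (symDerivation (mulRight k X)).toLinearMap.lTensor _ t)) := by
      intro t
      induction t with
      | zero => simp
      | add s t hs ht =>
        simp only [add_mul, map_add] at hs ht ⊢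
        linear_combination hs + ht
      | tmul a b =>
        simp only [mul_add, Algebra.TensorProduct.tmul_mul_tmul, map_add,
          LinearMap.rTensor_tmul, LinearMap.lTensor_tmul, Derivation.coeFn_coe,
          Derivation.leibniz, mul_one, TensorProduct.map_tmul, LinearMap.mul'_apply,
          LinearMap.comp_apply, smul_eq_mul, hφ, ih, map_sub, symDerivation_ι, mulRight_apply]
        ring
    simp only [braceExpand, LinearMap.comp_apply]
    rw [comul_mul_ι, key, comul_symDerivation]

variable (k L)

/-- A pre-Lie algebra carries a symmetric brace structure extending its product. -/
theorem exists_symmetricBrace : ∃ B : SymmetricBrace k L,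
    ∀ (n : ℕ) (X : L) (Y : Fin n → L),
      B.brace X (symMonomial k Y) = extendedCirc (fun S T : L => S * T) n X Y := by
  obtain ⟨φ, h1, hφ⟩ := exists_symmetric_extension k (L := L)
  refine ⟨⟨φ, h1, fun n X Y A => ?_⟩, fun n => ?_⟩
  · suffices h : φ (φ X (symMonomial k Y)) = φ X ∘ₗ braceExpand φ n Y from congr($h A)
    refine linearMap_ext_symMonomial fun m => ?_
    induction m with
    | zero =>
      intro Z
      have h : ∀ (n : ℕ) (Y : Fin n → L), braceExpand φ n Y 1 = symMonomial k Y := by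
        intro n
        induction n with
        | zero => simp [braceExpand]
        | succ n ih =>
          intro Y
          simp [braceExpand, Algebra.TensorProduct.one_def, h1, ih, symMonomial_tail]
      simp [h1, h]
    | succ m ih =>
      intro Z
      have hD : φ (φ X (symMonomial k Y)) (symDerivation (mulRight k (Z (Fin.last m)))
            (symMonomial k (Fin.init Z))) =
          φ X (braceExpand φ n Y (symDerivation (mulRight k (Z (Fin.last m)))
            (symMonomial k (Fin.init Z)))) := by
        -- The derivation preserves word length, so `ih` applies to each term.
        simp only [symDerivation_symMonomial, map_sum]
        exact Finset.sum_congr rfl fun i _ => ih _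
      have hm := ih (Fin.init Z)
      rw [LinearMap.comp_apply] at hm ⊢
      -- The derivative of `braceExpand φ n Y A` occurs with both signs and cancels.
      rw [symMonomial_init, hφ, hm, hD, braceExpand_mul_ι hφ, map_sub, map_add, hφ]
      abel
  · change ∀ X Y, φ X _ = _
    induction n with
    | zero => simp [extendedCirc, h1]
    | succ n ih =>
      intro X Y
      rw [symMonomial_init, hφ, symDerivation_symMonomial, map_sum]
      simp only [ih]
      rfl

end RightPreLieAlgebra

/-! ### The inverse functor and strict equality of the composites. -/

section CategoryIsomorphism

variable (k : Type u) [CommRing k]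

namespace RightPreLieAlgebra

/-- The symmetric brace structure of a pre-Lie algebra. -/
noncomputable def symmetricBrace (L : Type v) [RightPreLieRing L] [RightPreLieAlgebra k L] :
    SymmetricBrace k L :=
  (exists_symmetricBrace k L).choose

theorem symmetricBrace_symMonomial {L : Type v} [RightPreLieRing L] [RightPreLieAlgebra k L]
    (n : ℕ) (X : L) (Y : Fin n → L) :
    (symmetricBrace k L).brace X (symMonomial k Y) =
      extendedCirc (fun S T : L => S * T) n X Y :=
  (exists_symmetricBrace k L).choose_spec n X Y

theorem symmetricBrace_circ {L : Type v} [RightPreLieRing L] [RightPreLieAlgebra k L] (X Y : L) :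
    (symmetricBrace k L).circ X Y = X * Y := by
  have h := symmetricBrace_symMonomial k 1 X (fun _ => Y)
  simpa [symMonomial, extendedCirc, Fin.init, SymmetricBrace.circ] using h

end RightPreLieAlgebra

open RightPreLieAlgebra

/-- The functor sending a pre-Lie algebra to its symmetric brace algebra. -/
noncomputable def preLieToSymBrace : PreLieAlgCat.{u, v} k ⥤ SymBraceAlgCat.{u, v} k where
  obj L := SymBraceAlgCat.mk L.carrier (symmetricBrace k L.carrier)
  map {L M} f :=
    { lin := ((show L.carrier →ₙₐ[k] M.carrier from f) : L.carrier →ₗ[k] M.carrier)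
      map_brace := fun X A => by
        let g : L.carrier →ₙₐ[k] M.carrier := f
        suffices h : (g : L.carrier →ₗ[k] M.carrier) ∘ₗ (symmetricBrace k L.carrier).brace X =
            (symmetricBrace k M.carrier).brace (g X) ∘ₗ
              (symMap (g : L.carrier →ₗ[k] M.carrier)).toLinearMap from congr($h A)
        refine linearMap_ext_symMonomial fun n Y => ?_
        simp only [LinearMap.comp_apply, AlgHom.toLinearMap_apply, symMap_symMonomial,
          symmetricBrace_symMonomial]
        exact map_extendedCirc _ _ (g : L.carrier →ₗ[k] M.carrier).toAddMonoidHom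
          (fun x y => map_mul g x y) n X Y }

variable {k}

theorem SymBraceHom.heq_of_lin_eq {V W : Type v} [AddCommGroup V] [Module k V] [AddCommGroup W]
    [Module k W] {B B' : SymmetricBrace k V} {C C' : SymmetricBrace k W} (hB : B = B')
    (hC : C = C') (f : SymBraceHom (SymBraceAlgCat.mk V B) (SymBraceAlgCat.mk W C))
    (g : SymBraceHom (SymBraceAlgCat.mk V B') (SymBraceAlgCat.mk W C'))
    (h : f.lin = g.lin) : HEq f g := by
  subst hB hC
  exact heq_of_eq (SymBraceHom.ext h)

theorem SymmetricBrace.symmetricBrace_toRightPreLie {V : Type v} [AddCommGroup V] [Module k V]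
    (B : SymmetricBrace k V) :
    @symmetricBrace k _ V B.toRightPreLieRing B.toRightPreLieAlgebra = B :=
  SymmetricBrace.eq_of_brace_symMonomial fun n X Y =>
    (@symmetricBrace_symMonomial k _ V B.toRightPreLieRing B.toRightPreLieAlgebra n X Y).trans
      (B.brace_symMonomial n X Y).symm

variable (k)

theorem symBraceToPreLie_comp_preLieToSymBrace :
    symBraceToPreLie k ⋙ preLieToSymBrace k = 𝟭 (SymBraceAlgCat.{u, v} k) := by
  refine Functor.hext (fun V => ?_) fun V W f => ?_
  · exact congrArg (SymBraceAlgCat.mk V.carrier) V.str.symmetricBrace_toRightPreLie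
  · exact SymBraceHom.heq_of_lin_eq V.str.symmetricBrace_toRightPreLie
      W.str.symmetricBrace_toRightPreLie _ f rfl

variable {k}

/-- Two pre-Lie algebra structures with the same underlying module and product agree. -/
theorem PreLieAlgCat.mk_eq {L : Type v} {r r' : RightPreLieRing L}
    {a : @RightPreLieAlgebra k _ L r} {a' : @RightPreLieAlgebra k _ L r'}
    (hr : r = r') (ha : HEq a a') : @PreLieAlgCat.mk k _ L r a = @PreLieAlgCat.mk k _ L r' a' := by
  subst hr
  rw [eq_of_heq ha]

/-- The underlying map of a morphism of pre-Lie algebras. -/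
def PreLieAlgCat.homFun {L M : PreLieAlgCat.{u, v} k} (f : L ⟶ M) : L.carrier → M.carrier :=
  (show L.carrier →ₙₐ[k] M.carrier from f)

theorem PreLieAlgCat.hom_heq {L M : Type v} {r r' : RightPreLieRing L}
    {a : @RightPreLieAlgebra k _ L r} {a' : @RightPreLieAlgebra k _ L r'}
    {s s' : RightPreLieRing M}
    {b : @RightPreLieAlgebra k _ M s} {b' : @RightPreLieAlgebra k _ M s'}
    (hr : r = r') (ha : HEq a a') (hs : s = s') (hb : HEq b b')
    (f : @PreLieAlgCat.mk k _ L r a ⟶ @PreLieAlgCat.mk k _ M s b)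
    (g : @PreLieAlgCat.mk k _ L r' a' ⟶ @PreLieAlgCat.mk k _ M s' b')
    (h : ∀ x : L, homFun f x = homFun g x) : HEq f g := by
  subst hr hs
  obtain rfl := eq_of_heq ha
  obtain rfl := eq_of_heq hb
  exact heq_of_eq (NonUnitalAlgHom.ext h)

theorem RightPreLieAlgebra.toRightPreLieRing_symmetricBrace (L : Type v) [r : RightPreLieRing L]
    [RightPreLieAlgebra k L] : (symmetricBrace k L).toRightPreLieRing = r := by
  -- The additive data coincide definitionally; only the product needs an argument.
  refine RightPreLieRing.ext rfl rfl rfl rfl rfl rfl ?_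
  funext X Y
  exact symmetricBrace_circ k X Y

theorem RightPreLieAlgebra.toRightPreLieAlgebra_symmetricBrace (L : Type v) [r : RightPreLieRing L]
    [a : RightPreLieAlgebra k L] : HEq (symmetricBrace k L).toRightPreLieAlgebra a := by
  -- Generalizing the ring structure lets the equality of rings be substituted.
  have key : ∀ (r' : RightPreLieRing L) (a' : @RightPreLieAlgebra k _ L r')
      (_ : r' = r)
      (_ : ∀ (c : k) (x : L), a'.smul c x = a.smul c x), HEq a' a := by
    rintro _ a' rfl h
    refine heq_of_eq (RightPreLieAlgebra.ext ?_)
    funext c x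
    exact h c x
  exact key _ _ (toRightPreLieRing_symmetricBrace (k := k) L) fun _ _ => rfl

variable (k)

theorem preLieToSymBrace_comp_symBraceToPreLie :
    preLieToSymBrace k ⋙ symBraceToPreLie k = 𝟭 (PreLieAlgCat.{u, v} k) := by
  refine Functor.hext (fun L => ?_) fun L M f => ?_
  · exact PreLieAlgCat.mk_eq (toRightPreLieRing_symmetricBrace L.carrier)
      (toRightPreLieAlgebra_symmetricBrace L.carrier)
  · exact PreLieAlgCat.hom_heq (toRightPreLieRing_symmetricBrace L.carrier)
      (toRightPreLieAlgebra_symmetricBrace L.carrier)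
      (toRightPreLieRing_symmetricBrace M.carrier)
      (toRightPreLieAlgebra_symmetricBrace M.carrier) _ f fun _ => rfl

end CategoryIsomorphism

theorem corollary4p5 (k : Type u) [CommRing k] :
    -- a pre-Lie algebra carries a unique symmetric brace structure `X{Y₁ ⋯ Yₙ} = X ∘ (Y₁ ⋯ Yₙ)`
    (∀ (L : Type v) [RightPreLieRing L] [RightPreLieAlgebra k L],
      ∃! B : SymmetricBrace k L, ∀ (n : ℕ) (X : L) (Y : Fin n → L),
        B.brace X (symMonomial k Y) = extendedCirc (fun S T : L => S * T) n X Y) ∧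
    -- the braces of a symmetric brace algebra are the extension of the product `X ∘ Y = X{Y}`
    (∀ (V : Type v) [AddCommGroup V] [Module k V] (B : SymmetricBrace k V)
      (n : ℕ) (X : V) (Y : Fin n → V),
        B.brace X (symMonomial k Y) = extendedCirc B.circ n X Y) ∧
    -- the two constructions are mutually inverse functors
    (∃ G : PreLieAlgCat.{u, v} k ⥤ SymBraceAlgCat.{u, v} k,
      (∀ L : PreLieAlgCat.{u, v} k, ∃ B : SymmetricBrace k L.carrier,
        (∀ (n : ℕ) (X : L.carrier) (Y : Fin n → L.carrier),
          B.brace X (symMonomial k Y) =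
            extendedCirc (fun S T : L.carrier => S * T) n X Y) ∧
        G.obj L = SymBraceAlgCat.mk L.carrier B) ∧
      symBraceToPreLie k ⋙ G = 𝟭 (SymBraceAlgCat.{u, v} k) ∧
      G ⋙ symBraceToPreLie k = 𝟭 (PreLieAlgCat.{u, v} k)) := by
  refine ⟨fun L _ _ => ?_, fun V _ _ B => B.brace_symMonomial, preLieToSymBrace k,
    fun L => ⟨_, RightPreLieAlgebra.symmetricBrace_symMonomial k, rfl⟩,
    symBraceToPreLie_comp_preLieToSymBrace k, preLieToSymBrace_comp_symBraceToPreLie k⟩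
  refine ⟨RightPreLieAlgebra.symmetricBrace k L,
    RightPreLieAlgebra.symmetricBrace_symMonomial k, fun B hB => ?_⟩
  refine SymmetricBrace.eq_of_brace_symMonomial fun n X Y => ?_
  rw [hB, RightPreLieAlgebra.symmetricBrace_symMonomial]
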